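/- **Setting.** Let $n\ge 1$ and let $H:\mathbb R^n\times\mathbb R^n\to\mathbb R$, $H=H(p,y)$, be such that $p\mapsto H(p,y)$ is convex for every $y\in\mathbb R^n$; $\lim_{|p|\to\infty}\inf_{y\in\mathbb R^n}H(p,y)=+\infty$; and for every $R>0$, $H$ is uniformly continuous and bounded on $B_R\times\mathbb R^n$, where $B_R$ is the open ball of radius $R$ centered at $0$. Sub- and supersolutions of $$H(p+Du,y)=\mu \qquad (\ast)$$ are understood in the viscosity sense. For $p\in\mathbb R^n$ let $\overline H(p)$ be the infimum of all $\mu\in\mathbb R$ for which there is a globally Lipschitz function $w:\mathbb R^n\to\mathbb R$ that is a subsolution of $(\ast)$ in $\mathbb R^n$ and satisfies $\lim_{|y|\to\infty}|y|^{-1}w(y)=0$. **Proposition.** Let $p\in\mathbb R^n$, $\mu>\overline H(p)$, and let $D\subseteq\mathbb R^n$ be compact. Suppose that $u:\overline{\mathbb R^n\setminus D}\to\mathbb R$ is upper semicontinuous and a subsolution of $(\ast)$ in $\mathbb R^n\setminus D$, that $v:\overline{\mathbb R^n\setminus D}\to\mathbb R$ is lower semicontinuous and a supersolution of $(\ast)$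 in $\mathbb R^n\setminus D$, and that $$\liminf_{|x|\to\infty}\frac{v(x)}{|x|}>0\qquad\text{and}\qquad \limsup_{|x|\to\infty}\frac{u(x)}{|x|}<\infty .$$ Then $$\sup_{\overline{\mathbb R^n\setminus D}}(u-v)=\sup_{\partial D}(u-v)$$ (equivalently, $u-v\le\sup_{\partial D}(u-v)$ in $\mathbb R^n\setminus D$). If, moreover, $u-v$ is continuous up to $\partial D$, i.e. $(u-v)(y)\to(u-v)(x)$ as $y\to x$ with $y\in\mathbb R^n\setminus D$ for every $x\in\partial D$, then $$\sup_{\mathbb R^n\setminus D}(u-v)=\sup_{\partial D}(u-v).$$ Suprema are taken in $[-\infty,\infty]$, with $\sup\emptyset=-\infty$. -/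

import Mathlib

open Filter Topology Bornology
open scoped NNReal

noncomputable section

namespace Eikonal

/-- The Hamiltonian `H = H(p, y)` is convex in `p`, coercive in `p` uniformly in `y`
(that is, `inf_y H(p, y) → +∞` as `|p| → ∞`), and uniformly continuous and bounded on
`B_R × ℝⁿ` for every `R > 0`. -/
structure IsAdmissible {n : ℕ}
    (H : EuclideanSpace ℝ (Fin n) → EuclideanSpace ℝ (Fin n) → ℝ) : Prop where
  convex : ∀ y, ConvexOn ℝ Set.univ (fun p => H p y)
  coercive : ∀ M : ℝ, ∃ R : ℝ, ∀ p, R ≤ ‖p‖ → ∀ y, M ≤ H p y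
  uniformContinuousOn : ∀ R : ℝ, 0 < R →
    UniformContinuousOn
      (fun z : EuclideanSpace ℝ (Fin n) × EuclideanSpace ℝ (Fin n) => H z.1 z.2)
      (Metric.ball 0 R ×ˢ Set.univ)
  bounded : ∀ R : ℝ, 0 < R → ∃ C : ℝ, ∀ p ∈ Metric.ball (0 : EuclideanSpace ℝ (Fin n)) R,
    ∀ y, |H p y| ≤ C

/-- `H(p + Du, y) ≤ μ` in `U` in the viscosity sense: the inequality holds for `Dφ` at every
point `x ∈ U` where `u - φ` has a local maximum, `φ` being a `C¹` test function.
Semicontinuity of `u` is stated separately where it is needed. -/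
def ViscSubsol {n : ℕ} (H : EuclideanSpace ℝ (Fin n) → EuclideanSpace ℝ (Fin n) → ℝ)
    (p : EuclideanSpace ℝ (Fin n)) (μ : ℝ) (U : Set (EuclideanSpace ℝ (Fin n)))
    (u : EuclideanSpace ℝ (Fin n) → ℝ) : Prop :=
  ∀ φ : EuclideanSpace ℝ (Fin n) → ℝ, ContDiff ℝ 1 φ → ∀ x ∈ U,
    IsLocalMaxOn (fun y => u y - φ y) U x → H (p + gradient φ x) x ≤ μ

/-- `H(p + Dv, y) ≥ μ` in `U` in the viscosity sense: the inequality holds for `Dφ` at every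
point `x ∈ U` where `v - φ` has a local minimum, `φ` being a `C¹` test function. -/
def ViscSupersol {n : ℕ} (H : EuclideanSpace ℝ (Fin n) → EuclideanSpace ℝ (Fin n) → ℝ)
    (p : EuclideanSpace ℝ (Fin n)) (μ : ℝ) (U : Set (EuclideanSpace ℝ (Fin n)))
    (v : EuclideanSpace ℝ (Fin n) → ℝ) : Prop :=
  ∀ φ : EuclideanSpace ℝ (Fin n) → ℝ, ContDiff ℝ 1 φ → ∀ x ∈ U,
    IsLocalMinOn (fun y => v y - φ y) U x → μ ≤ H (p + gradient φ x) x

/-- The effective Hamiltonian: the infimum of the `μ` for which `H(p + Dw, y) ≤ μ` in `ℝⁿ` has a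
(globally) Lipschitz viscosity solution `w` that is strictly sublinear at infinity.
For admissible `H` and `n ≥ 1` the set is nonempty and bounded below. -/
def effectiveH {n : ℕ} (H : EuclideanSpace ℝ (Fin n) → EuclideanSpace ℝ (Fin n) → ℝ)
    (p : EuclideanSpace ℝ (Fin n)) : ℝ :=
  sInf {μ : ℝ | ∃ w : EuclideanSpace ℝ (Fin n) → ℝ,
    (∃ K : ℝ≥0, LipschitzWith K w) ∧
    ViscSubsol H p μ Set.univ w ∧
    Tendsto (fun y => w y / ‖y‖) (cobounded (EuclideanSpace ℝ (Fin n))) (𝓝 0)}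

end Eikonal

end

/-! ### The smooth minimum. -/

namespace Eikonal

/-! Above the effective level there is a sublinear subsolution `w` at some `μ' < μ`. Replace `u` by
`softMin u (w + C)`. As `v` grows linearly and `w + C` does not, the difference with `v` tends to
`-∞`, so a maximum is attained. The gradient of the smooth minimum is a convex combination of those
of `u` and `w` with positive weights, so convexity of `H` makes it a strict subsolution locally; a
plain minimum would lose strictness where `u < w`. Hence there is no interior maximum
(`not_isMaxOn_softMin_sub`), and on the boundary `softMin u (w + C) ≤ u`. Letting `C → ∞` recovers
`u` (`sub_le_of_forall_frontier`).

For merely semicontinuous functions the gradient formula is replaced by tripling variables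
(`exists_isMaxOn_penalized`), an exponential change of unknown (`ViscSubsol.le_of_exp_le`), and a
quantitative convexity estimate (`IsAdmissible.exists_modulus`). -/

/-- The smooth minimum `-log (e⁻ᵃ + e⁻ᵇ)`. -/
noncomputable def softMin (a b : ℝ) : ℝ := -Real.log (Real.exp (-a) + Real.exp (-b))

theorem exp_neg_softMin (a b : ℝ) :
    Real.exp (-softMin a b) = Real.exp (-a) + Real.exp (-b) := by
  rw [softMin, neg_neg, Real.exp_log (by positivity)]

theorem softMin_comm (a b : ℝ) : softMin a b = softMin b a := by
  rw [softMin, softMin, add_comm]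

theorem softMin_le_left (a b : ℝ) : softMin a b ≤ a := by
  have h := exp_neg_softMin a b
  have : Real.exp (-a) ≤ Real.exp (-softMin a b) := by
    rw [h]; linarith [Real.exp_pos (-b)]
  linarith [Real.exp_le_exp.1 this]

theorem softMin_le_right (a b : ℝ) : softMin a b ≤ b :=
  softMin_comm a b ▸ softMin_le_left b a

theorem softMin_mono {a a' b b' : ℝ} (ha : a ≤ a') (hb : b ≤ b') :
    softMin a b ≤ softMin a' b' := by
  unfold softMin
  gcongr

theorem continuous_softMin : Continuous fun q : ℝ × ℝ => softMin q.1 q.2 := by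
  unfold softMin
  refine (Continuous.log (by fun_prop) fun q => ?_).neg
  positivity

theorem tendsto_softMin_add_atTop (a b : ℝ) :
    Tendsto (fun C : ℝ => softMin a (b + C)) atTop (𝓝 a) := by
  have h1 : Tendsto (fun C : ℝ => Real.exp (-a) + Real.exp (-(b + C))) atTop
      (𝓝 (Real.exp (-a) + 0)) :=
    tendsto_const_nhds.add (Real.tendsto_exp_neg_atTop_nhds_zero.comp
      (tendsto_atTop_add_const_left _ b tendsto_id))
  rw [add_zero] at h1
  have h2 := (h1.log (Real.exp_pos _).ne').neg
  simpa [softMin] using h2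

/-- The weight of the first argument in the derivative of `softMin`. -/
noncomputable def softWeight (a b : ℝ) : ℝ := Real.exp (softMin a b - a)

theorem softWeight_pos (a b : ℝ) : 0 < softWeight a b := Real.exp_pos _

theorem softWeight_add_softWeight (a b : ℝ) : softWeight a b + softWeight b a = 1 := by
  rw [softWeight, softWeight, softMin_comm b a, sub_eq_add_neg, sub_eq_add_neg,
    Real.exp_add, Real.exp_add, ← mul_add, ← exp_neg_softMin, ← Real.exp_add]
  simp

/-- In exponential variables the smooth minimum is a sum, so varying one argument acts affinely.
This matches the hypothesis of `ViscSubsol.le_of_exp_le`. -/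
theorem exp_neg_softMin_sub (a a' b : ℝ) :
    Real.exp (-(softMin a' b - softMin a b)) =
      softWeight a b * Real.exp (-(a' - a)) + (1 - softWeight a b) := by
  rw [← softWeight_add_softWeight a b, add_sub_cancel_left, softWeight, softWeight, ← Real.exp_add,
    softMin_comm b a, show -(softMin a' b - softMin a b) = softMin a b + -softMin a' b by ring,
    Real.exp_add, exp_neg_softMin, mul_add, ← Real.exp_add, ← Real.exp_add]
  ring_nf

/-! ### Semicontinuity and penalization. -/

section Semicontinuity

variable {α : Type*} [TopologicalSpace α] {s : Set α}

theorem upperSemicontinuousOn_softMin {f g : α → ℝ} (hf : UpperSemicontinuousOn f s)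
    (hg : UpperSemicontinuousOn g s) :
    UpperSemicontinuousOn (fun x => softMin (f x) (g x)) s := by
  intro x hx c hc
  have hcont : ContinuousAt (fun t : ℝ => softMin (f x + t) (g x + t)) 0 :=
    (continuous_softMin.comp (by fun_prop : Continuous fun t : ℝ => (f x + t, g x + t))).continuousAt
  have hlt : ∀ᶠ t : ℝ in 𝓝[>] 0, softMin (f x + t) (g x + t) < c :=
    (hcont.eventually_lt continuousAt_const (by simpa using hc)).filter_mono nhdsWithin_le_nhds
  obtain ⟨t, ht, ht0⟩ := (hlt.and self_mem_nhdsWithin).exists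
  have ht0 : 0 < t := ht0
  filter_upwards [hf x hx (f x + t) (by linarith), hg x hx (g x + t) (by linarith)] with y h1 h2
  exact (softMin_mono h1.le h2.le).trans_lt ht

theorem upperSemicontinuousOn_sub {f g : α → ℝ} (hf : UpperSemicontinuousOn f s)
    (hg : LowerSemicontinuousOn g s) : UpperSemicontinuousOn (fun x => f x - g x) s := by
  intro x hx c hc
  have hc : f x - g x < c := hc
  filter_upwards [hf x hx (f x + (c - (f x - g x)) / 2) (by linarith),
    hg x hx (g x - (c - (f x - g x)) / 2) (by linarith)] with y h1 h2
  linarith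

/-- Penalization: if `X₀` is the only maximum point of `G` on the zero set of `Q`, then `G - k Q`
has a maximum point near `X₀` when `k` is large. -/
theorem exists_isMaxOn_penalized {K V : Set α} (hK : IsCompact K) {G Q : α → ℝ}
    (hG : UpperSemicontinuousOn G K) (hQ : Continuous Q) (hQ0 : ∀ X, 0 ≤ Q X) {X₀ : α}
    (hX₀ : X₀ ∈ K) (hQX₀ : Q X₀ = 0) (hmax : ∀ X ∈ K, Q X = 0 → X ≠ X₀ → G X < G X₀)
    (hV : V ∈ 𝓝 X₀) :
    ∃ k : ℝ, ∃ X ∈ K, X ∈ V ∧ G X₀ ≤ G X ∧ IsMaxOn (fun X => G X - k * Q X) K X := by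
  obtain ⟨W, hWV, hWo, hXW⟩ := mem_nhds_iff.1 hV
  -- Compactness makes a local bound on `k` uniform: near a zero of `Q`, semicontinuity of `G`
  -- suffices with `k₀ = 0`; elsewhere `Q` is bounded below and a large `k` wins.
  have key : ∃ k₀ : ℝ, 0 ≤ k₀ ∧ ∀ X ∈ K \ W, ∀ k ≥ k₀, G X - k * Q X < G X₀ := by
    refine (hK.diff hWo).induction_on
      (p := fun s => ∃ k₀ : ℝ, 0 ≤ k₀ ∧ ∀ X ∈ s, ∀ k ≥ k₀, G X - k * Q X < G X₀) ?_ ?_ ?_ ?_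
    · exact ⟨0, le_rfl, by simp⟩
    · rintro s t hst ⟨k, hk, h⟩
      exact ⟨k, hk, fun X hX => h X (hst hX)⟩
    · rintro s t ⟨k, hk, h⟩ ⟨l, hl, h'⟩
      refine ⟨max k l, le_max_of_le_left hk, ?_⟩
      rintro X (hX | hX) m hm
      · exact h X hX m (le_trans (le_max_left _ _) hm)
      · exact h' X hX m (le_trans (le_max_right _ _) hm)
    · rintro X ⟨hXK, hXW'⟩
      rcases (hQ0 X).eq_or_lt with h0 | hpos
      · have hlt := hmax X hXK h0.symm (by rintro rfl; exact hXW' hXW)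
        refine ⟨_, nhdsWithin_mono X Set.sdiff_subset (hG X hXK _ hlt), 0, le_rfl,
          fun Y hY k hk => ?_⟩
        have hY : G Y < G X₀ := hY
        nlinarith [mul_nonneg hk (hQ0 Y)]
      · have h1 := nhdsWithin_mono X (Set.sdiff_subset (s := K) (t := W))
          (hG X hXK (G X + 1) (by linarith))
        have h2 : {Y | Q X / 2 < Q Y} ∈ 𝓝[K \ W] X :=
          mem_nhdsWithin_of_mem_nhds
            (hQ.continuousAt.eventually (lt_mem_nhds (by linarith : Q X / 2 < Q X)))
        refine ⟨_, inter_mem h1 h2, max 0 ((G X + 1 - G X₀) / (Q X / 2)), le_max_left _ _, ?_⟩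
        rintro Y ⟨hY1, hY2⟩ k hk
        have hY1 : G Y < G X + 1 := hY1
        have hY2 : Q X / 2 < Q Y := hY2
        have hk0 : 0 ≤ k := (le_max_left _ _).trans hk
        have hk1 := (div_le_iff₀ (by linarith)).1 ((le_max_right _ _).trans hk)
        nlinarith [mul_le_mul_of_nonneg_left hY2.le hk0]
  obtain ⟨k, hk0, hk⟩ := key
  have husc : UpperSemicontinuousOn (fun X => G X - k * Q X) K :=
    upperSemicontinuousOn_sub hG ((continuous_const.mul hQ).lowerSemicontinuous.lowerSemicontinuousOn _)
  obtain ⟨X, hXK, hX⟩ := husc.exists_isMaxOn ⟨X₀, hX₀⟩ hK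
  have hle : G X₀ ≤ G X - k * Q X := by simpa [hQX₀] using hX hX₀
  refine ⟨k, X, hXK, hWV ?_, ?_, hX⟩
  · by_contra hXW'
    exact absurd (hk X ⟨hXK, hXW'⟩ k le_rfl) (not_lt.2 hle)
  · nlinarith [mul_nonneg hk0 (hQ0 X)]

end Semicontinuity

/-! ### Test functions. -/

section TestFunctions

variable {n : ℕ} {H : EuclideanSpace ℝ (Fin n) → EuclideanSpace ℝ (Fin n) → ℝ}
  {p : EuclideanSpace ℝ (Fin n)} {μ : ℝ} {U : Set (EuclideanSpace ℝ (Fin n))}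

theorem contDiff_mul_norm_sub_sq (k : ℝ) (c : EuclideanSpace ℝ (Fin n)) :
    ContDiff ℝ 1 fun x => k * ‖x - c‖ ^ 2 :=
  contDiff_const.mul ((contDiff_id.sub contDiff_const).norm_sq ℝ)

theorem hasGradientAt_mul_norm_sub_sq (k : ℝ) (c x : EuclideanSpace ℝ (Fin n)) :
    HasGradientAt (fun x => k * ‖x - c‖ ^ 2) ((2 * k) • (x - c)) x := by
  rw [hasGradientAt_iff_hasFDerivAt]
  refine ((((hasFDerivAt_id x).sub_const c).norm_sq).const_mul k).congr_fderiv ?_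
  ext y
  simp only [id, smul_apply, ContinuousLinearMap.comp_apply, innerSL_apply_apply,
    ContinuousLinearMap.id_apply, InnerProductSpace.toDual_apply_apply, real_inner_smul_left,
    smul_eq_mul, nsmul_eq_mul]
  push_cast
  ring

/-- Test functions must be `C¹` on the whole space, where `log (1 + t)` may be undefined; this
polynomial minorant has the same value and slope at `t = 0`. -/
theorem sub_two_mul_sq_le_log_one_add {t : ℝ} (ht : |t| < 1 / 2) :
    t - 2 * t ^ 2 ≤ Real.log (1 + t) := by
  have h := abs_lt.1 ht
  refine le_trans ?_ (Real.one_sub_inv_le_log_of_pos (by linarith))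
  have : (1 + t)⁻¹ ≤ 1 - t + 2 * t ^ 2 := by
    rw [inv_le_iff_one_le_mul₀ (by linarith)]
    nlinarith [mul_nonneg (sq_nonneg t) (by linarith : 0 ≤ 1 + 2 * t)]
  linarith

/-- If `-log (θ e⁻ᵘ + (1 - θ))`, with `u` normalized at `x`, is touched from above at `x` by `h`, then
`u` is touched from above by a test function whose gradient is `θ⁻¹` times that of `h`. -/
theorem ViscSubsol.le_of_exp_le {u h : EuclideanSpace ℝ (Fin n) → ℝ} (hu : ViscSubsol H p μ U u)
    {θ : ℝ} (hθ : 0 < θ) {x g : EuclideanSpace ℝ (Fin n)} (hx : x ∈ U) (hh : ContDiff ℝ 1 h)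
    (hg : HasGradientAt h g x)
    (hle : ∀ᶠ y in 𝓝[U] x,
      Real.exp (-(h y - h x)) ≤ θ * Real.exp (-(u y - u x)) + (1 - θ)) :
    H (p + θ⁻¹ • g) x ≤ μ := by
  set t : EuclideanSpace ℝ (Fin n) → ℝ := fun y => θ⁻¹ * (Real.exp (-(h y - h x)) - 1) with ht
  have htC : ContDiff ℝ 1 t := by
    rw [ht]; fun_prop
  have htx : t x = 0 := by simp [ht]
  have hgt : HasFDerivAt t (-(θ⁻¹ • InnerProductSpace.toDual ℝ _ g)) x := by
    have h1 := ((((hasGradientAt_iff_hasFDerivAt.1 hg).sub_const (h x)).neg.exp).sub_const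
      1).const_mul θ⁻¹
    refine h1.congr_fderiv ?_
    simp
  have hgψ : HasGradientAt (fun y => -t y + 2 * t y ^ 2) (θ⁻¹ • g) x := by
    rw [hasGradientAt_iff_hasFDerivAt]
    refine (hgt.neg.add ((hgt.pow 2).const_mul 2)).congr_fderiv ?_
    simp [htx]
  rw [← hgψ.gradient]
  refine hu _ (htC.neg.add (contDiff_const.mul (htC.pow 2))) x hx ?_
  have hsmall : ∀ᶠ y in 𝓝[U] x, |t y| < 1 / 2 := by
    refine (htC.continuous.abs.continuousAt.eventually_lt continuousAt_const ?_).filter_mono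
      nhdsWithin_le_nhds
    simp [htx]
  filter_upwards [hle, hsmall] with y hy hy'
  have h1 : 1 + t y ≤ Real.exp (-(u y - u x)) := by
    have : θ * (1 + t y) ≤ θ * Real.exp (-(u y - u x)) := by
      have : θ * t y = Real.exp (-(h y - h x)) - 1 := by
        simp only [ht]; field_simp
      rw [mul_add, this]; linarith
    exact le_of_mul_le_mul_left this hθ
  have h2 : Real.log (1 + t y) ≤ -(u y - u x) :=
    (Real.log_le_iff_le_exp (by linarith [(abs_lt.1 hy').1])).2 h1
  have h3 := sub_two_mul_sq_le_log_one_add hy'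
  simp only [htx]
  linarith

end TestFunctions

end Eikonal

namespace Eikonal

/-! ### Comparison on exterior domains. -/

section Comparison

variable {n : ℕ} {H : EuclideanSpace ℝ (Fin n) → EuclideanSpace ℝ (Fin n) → ℝ}
  {p : EuclideanSpace ℝ (Fin n)} {μ μ' : ℝ} {U : Set (EuclideanSpace ℝ (Fin n))}

/-- If the gradient inequalities at three nearby points are compatible with convexity, the level of
the supersolution cannot exceed a strict convex combination of the subsolution levels. -/
theorem IsAdmissible.exists_modulus (hH : IsAdmissible H) (p : EuclideanSpace ℝ (Fin n))
    (hμ : μ' < μ) {c : ℝ} (hc : 0 < c) :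
    ∃ η > 0, ∀ θ₁ θ₂ : ℝ, 0 ≤ θ₁ → c ≤ θ₂ → θ₁ + θ₂ = 1 →
      ∀ q₁ q₂ q₃ x y z : EuclideanSpace ℝ (Fin n),
        dist x z < η → dist y z < η → ‖q₃‖ < η → H (p + q₁) x ≤ μ → H (p + q₂) y ≤ μ' →
        H (p + (θ₁ • q₁ + θ₂ • q₂ + q₃)) z < μ := by
  obtain ⟨R₀, hR₀⟩ := hH.coercive (μ + 1)
  set R := max R₀ 1 with hR
  have hR1 : 1 ≤ R := le_max_right _ _
  have hbound : ∀ q x, H q x ≤ μ → ‖q‖ < R := by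
    intro q x hq
    by_contra hcon
    have := hR₀ q ((le_max_left _ _).trans (not_lt.1 hcon)) x
    linarith
  -- The convex combination gains at least `c * (μ - μ') = 2ε`; moving the base points to `z` costs
  -- `ε / 2`, and adding `q₃` another `ε / 2`.
  set ε := c * (μ - μ') / 2 with hε
  have hεpos : 0 < ε := by
    have := mul_pos hc (sub_pos.2 hμ)
    positivity
  obtain ⟨η, hη, hunif⟩ := Metric.uniformContinuousOn_iff.1
    (hH.uniformContinuousOn (R + 1) (by linarith)) (ε / 2) (by linarith)
  refine ⟨min η 1, lt_min hη one_pos, ?_⟩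
  intro θ₁ θ₂ hθ₁ hθ₂ hsum q₁ q₂ q₃ x y z hx hy hq₃ h₁ h₂
  have b₁ := hbound _ _ h₁
  have b₂ := hbound _ _ (h₂.trans hμ.le)
  have e₁ : H (p + q₁) z < μ + ε / 2 := by
    have := hunif (p + q₁, x) ⟨by simpa using b₁.trans (by linarith), trivial⟩
      (p + q₁, z) ⟨by simpa using b₁.trans (by linarith), trivial⟩
      (by simpa [Prod.dist_eq, hη] using hx.trans_le (min_le_left _ _))
    rw [Real.dist_eq] at this
    linarith [(abs_lt.1 this).1]
  have e₂ : H (p + q₂) z < μ' + ε / 2 := by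
    have := hunif (p + q₂, y) ⟨by simpa using b₂.trans (by linarith), trivial⟩
      (p + q₂, z) ⟨by simpa using b₂.trans (by linarith), trivial⟩
      (by simpa [Prod.dist_eq, hη] using hy.trans_le (min_le_left _ _))
    rw [Real.dist_eq] at this
    linarith [(abs_lt.1 this).1]
  have hconv := (hH.convex z).2 (Set.mem_univ (p + q₁)) (Set.mem_univ (p + q₂)) hθ₁
    (hc.le.trans hθ₂) hsum
  have hcomb : θ₁ • (p + q₁) + θ₂ • (p + q₂) = p + (θ₁ • q₁ + θ₂ • q₂) := by
    rw [smul_add, smul_add, add_add_add_comm, ← add_smul, hsum, one_smul]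
  simp only [hcomb, smul_eq_mul] at hconv
  have bcomb : ‖p + (θ₁ • q₁ + θ₂ • q₂)‖ < R := by
    have := (convex_ball (0 : EuclideanSpace ℝ (Fin n)) R) (by simpa using b₁ : p + q₁ ∈ _)
      (by simpa using b₂ : p + q₂ ∈ _) hθ₁ (hc.le.trans hθ₂) hsum
    rw [hcomb] at this
    simpa using this
  have e₃ : H (p + (θ₁ • q₁ + θ₂ • q₂ + q₃)) z < H (p + (θ₁ • q₁ + θ₂ • q₂)) z + ε / 2 := by
    have hb : ‖p + (θ₁ • q₁ + θ₂ • q₂ + q₃)‖ < R + 1 := by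
      rw [← add_assoc]
      exact (norm_add_le _ _).trans_lt (add_lt_add bcomb (hq₃.trans_le (min_le_right _ _)))
    have := hunif (p + (θ₁ • q₁ + θ₂ • q₂ + q₃), z) ⟨by simpa using hb, trivial⟩
      (p + (θ₁ • q₁ + θ₂ • q₂), z) ⟨by simpa using bcomb.trans (by linarith), trivial⟩
      (by simpa [Prod.dist_eq, dist_eq_norm, hη] using hq₃.trans_le (min_le_left _ _))
    rw [Real.dist_eq] at this
    linarith [(abs_lt.1 this).2]
  have f₁ := mul_le_mul_of_nonneg_left e₁.le hθ₁
  have f₂ := mul_le_mul_of_nonneg_left e₂.le (hc.le.trans hθ₂)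
  have f₃ : c * (μ - μ') ≤ θ₂ * (μ - μ') := mul_le_mul_of_nonneg_right hθ₂ (by linarith)
  have hθ : θ₁ = 1 - θ₂ := by linarith
  subst hθ
  nlinarith

/-- The smooth minimum of a subsolution and a strict subsolution, minus a supersolution, has no
interior maximum. -/
theorem not_isMaxOn_softMin_sub (hH : IsAdmissible H) (hμ : μ' < μ) (hU : IsOpen U)
    {u w v : EuclideanSpace ℝ (Fin n) → ℝ} (hu : UpperSemicontinuousOn u U)
    (hw : UpperSemicontinuousOn w U) (hv : LowerSemicontinuousOn v U)
    (husub : ViscSubsol H p μ U u) (hwsub : ViscSubsol H p μ' U w)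
    (hvsuper : ViscSupersol H p μ U v) {x₀ : EuclideanSpace ℝ (Fin n)} (hx₀ : x₀ ∈ U) :
    ¬ IsMaxOn (fun x => softMin (u x) (w x) - v x) U x₀ := by
  intro hmax
  -- Lower bound for the weight of `w` at the penalized maximum, independent of `k`: semicontinuity
  -- of `v` and of `w` each costs at most 1 in the exponent.
  set c := Real.exp (softMin (u x₀) (w x₀) - w x₀ - 2) with hc
  obtain ⟨η, hη, hmod⟩ := hH.exists_modulus p hμ (c := c) (Real.exp_pos _)
  obtain ⟨r, hr, hrU⟩ := Metric.nhds_basis_closedBall.mem_iff.1 (hU.mem_nhds hx₀)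
  set B := Metric.closedBall x₀ r with hB
  have hx₀B : x₀ ∈ B := Metric.mem_closedBall_self hr.le
  have hBc : IsCompact B := isCompact_closedBall x₀ r
  -- Separate variables let `u`, `w` and `v` be tested one at a time; the term in `x₀` makes the
  -- maximum strict on the diagonal, the zero set of `Q`.
  let G : EuclideanSpace ℝ (Fin n) × EuclideanSpace ℝ (Fin n) × EuclideanSpace ℝ (Fin n) → ℝ :=
    fun X => softMin (u X.1) (w X.2.1) - (v X.2.2 + 1 * ‖X.2.2 - x₀‖ ^ 2)
  let Q : EuclideanSpace ℝ (Fin n) × EuclideanSpace ℝ (Fin n) × EuclideanSpace ℝ (Fin n) → ℝ :=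
    fun X => ‖X.1 - X.2.2‖ ^ 2 + ‖X.2.1 - X.2.2‖ ^ 2
  have hGusc : UpperSemicontinuousOn G (B ×ˢ B ×ˢ B) := by
    refine upperSemicontinuousOn_sub (upperSemicontinuousOn_softMin ?_ ?_) (.add ?_ ?_)
    · exact UpperSemicontinuousOn.comp hu continuous_fst.continuousOn fun X hX => hrU hX.1
    · exact UpperSemicontinuousOn.comp hw (by fun_prop) fun X hX => hrU hX.2.1
    · exact LowerSemicontinuousOn.comp hv (by fun_prop) fun X hX => hrU hX.2.2
    · exact (by fun_prop : Continuous _).lowerSemicontinuous.lowerSemicontinuousOn _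
  have hvx : ∀ᶠ y in 𝓝 x₀, v x₀ - 1 < v y := by
    have := hv x₀ hx₀ (v x₀ - 1) (by linarith)
    rwa [hU.nhdsWithin_eq hx₀] at this
  have hwx : ∀ᶠ y in 𝓝 x₀, w y < w x₀ + 1 := by
    have := hw x₀ hx₀ (w x₀ + 1) (by linarith)
    rwa [hU.nhdsWithin_eq hx₀] at this
  have hball : ∀ᶠ y in 𝓝 x₀, dist y x₀ < min r (η / 2) :=
    Metric.ball_mem_nhds x₀ (lt_min hr (by linarith))
  have hV := (hball.prod_nhds ((hball.and hwx).prod_nhds (hball.and hvx)))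
  obtain ⟨k, ⟨x, y, z⟩, -, ⟨hx, ⟨hy, hwy⟩, hz, hvz⟩, hGle, hXmax⟩ :=
    exists_isMaxOn_penalized (hBc.prod (hBc.prod hBc)) hGusc
      (Q := Q) (X₀ := (x₀, x₀, x₀)) (by fun_prop) (fun X => by positivity)
      ⟨hx₀B, hx₀B, hx₀B⟩ (by simp [Q]) (by
        rintro ⟨x, y, z⟩ ⟨hx, -⟩ hQ hne
        simp only [Q] at hQ
        obtain rfl : x = z := by
          have : ‖x - z‖ ^ 2 = 0 := by nlinarith [sq_nonneg ‖x - z‖, sq_nonneg ‖y - z‖]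
          simpa [sub_eq_zero] using this
        obtain rfl : y = x := by simpa [sub_eq_zero] using hQ
        have hne' : y ≠ x₀ := by rintro rfl; exact hne rfl
        have h1 : softMin (u y) (w y) - v y ≤ softMin (u x₀) (w x₀) - v x₀ := hmax (hrU hx)
        have h2 : 0 < ‖y - x₀‖ := norm_pos_iff.2 (sub_ne_zero.2 hne')
        simp only [G, sub_self, norm_zero]
        nlinarith [pow_pos h2 2]) hV
  have hnear : ∀ {a}, dist a x₀ < min r (η / 2) → a ∈ U ∧ B ∈ 𝓝[U] a := by
    intro a ha
    have haB : a ∈ Metric.ball x₀ r := ha.trans_le (min_le_left _ _)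
    exact ⟨hrU (Metric.ball_subset_closedBall haB), mem_nhdsWithin_of_mem_nhds
      (mem_of_superset (Metric.isOpen_ball.mem_nhds haB) Metric.ball_subset_closedBall)⟩
  have hmem : ∀ {a}, dist a x₀ < min r (η / 2) → a ∈ B :=
    fun ha => (ha.trans_le (min_le_left _ _)).le
  have hmaxle : ∀ a ∈ B, ∀ b ∈ B, ∀ e ∈ B,
      softMin (u a) (w b) - (v e + 1 * ‖e - x₀‖ ^ 2) - k * (‖a - e‖ ^ 2 + ‖b - e‖ ^ 2) ≤
      softMin (u x) (w y) - (v z + 1 * ‖z - x₀‖ ^ 2) - k * (‖x - z‖ ^ 2 + ‖y - z‖ ^ 2) :=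
    fun a ha b hb e he => hXmax (a := (a, b, e)) ⟨ha, hb, he⟩
  have hu' := husub.le_of_exp_le (softWeight_pos (u x) (w y)) (hnear hx).1
    (contDiff_mul_norm_sub_sq k z) (hasGradientAt_mul_norm_sub_sq k z x) (by
      filter_upwards [(hnear hx).2] with a ha
      rw [← exp_neg_softMin_sub, Real.exp_le_exp]
      linarith [hmaxle a ha y (hmem hy) z (hmem hz)])
  have hw' := hwsub.le_of_exp_le (softWeight_pos (w y) (u x)) (hnear hy).1
    (contDiff_mul_norm_sub_sq k z) (hasGradientAt_mul_norm_sub_sq k z y) (by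
      filter_upwards [(hnear hy).2] with b hb
      rw [← exp_neg_softMin_sub, Real.exp_le_exp, softMin_comm _ (u x), softMin_comm _ (u x)]
      linarith [hmaxle x (hmem hx) b hb z (hmem hz)])
  -- The first two terms are the weighted gradients obtained for `u` and `w`; the last plays the
  -- role of the small `q₃`.
  have hgrad : HasGradientAt
      (fun e => -(k * ‖e - x‖ ^ 2 + k * ‖e - y‖ ^ 2 + 1 * ‖e - x₀‖ ^ 2))
      ((2 * k) • (x - z) + (2 * k) • (y - z) + (2 : ℝ) • (x₀ - z)) z := by
    rw [hasGradientAt_iff_hasFDerivAt]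
    refine (((hasGradientAt_mul_norm_sub_sq k x z).hasFDerivAt.add
      (hasGradientAt_mul_norm_sub_sq k y z).hasFDerivAt).add
      (hasGradientAt_mul_norm_sub_sq 1 x₀ z).hasFDerivAt).neg.congr_fderiv ?_
    rw [← map_add, ← map_add, ← map_neg]
    congr 1
    module
  have hv' := hvsuper _ (((contDiff_mul_norm_sub_sq k x).add (contDiff_mul_norm_sub_sq k y)).add
    (contDiff_mul_norm_sub_sq 1 x₀)).neg z (hnear hz).1 (by
      filter_upwards [(hnear hz).2] with e he
      have := hmaxle x (hmem hx) y (hmem hy) e he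
      rw [norm_sub_rev e x, norm_sub_rev e y, norm_sub_rev z x, norm_sub_rev z y]
      linarith)
  rw [hgrad.gradient] at hv'
  refine absurd hv' (not_le.2 ?_)
  have hsum := softWeight_add_softWeight (u x) (w y)
  have hcle : c ≤ softWeight (w y) (u x) := by
    rw [hc, softWeight, Real.exp_le_exp, softMin_comm (w y)]
    simp only [G, sub_self, norm_zero] at hGle
    nlinarith [sq_nonneg ‖z - x₀‖]
  have hdist : ∀ {a b}, dist a x₀ < min r (η / 2) → dist b x₀ < min r (η / 2) → dist a b < η := by
    intro a b ha hb
    have := dist_triangle_right a b x₀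
    linarith [ha.trans_le (min_le_right _ _), hb.trans_le (min_le_right _ _)]
  have := hmod _ _ (softWeight_pos (u x) (w y)).le hcle hsum _ _ ((2 : ℝ) • (x₀ - z)) x y z
    (hdist hx hz) (hdist hy hz) (by
      rw [norm_smul, ← dist_eq_norm, dist_comm]
      simp only [Real.norm_ofNat]
      linarith [hz.trans_le (min_le_right _ _)]) hu' hw'
  rwa [smul_inv_smul₀ (softWeight_pos _ _).ne', smul_inv_smul₀ (softWeight_pos _ _).ne'] at this

theorem ViscSubsol.add_const {w : EuclideanSpace ℝ (Fin n) → ℝ} (hw : ViscSubsol H p μ U w)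
    (C : ℝ) : ViscSubsol H p μ U fun x => w x + C := by
  intro φ hφ x hx hmax
  refine hw φ hφ x hx ?_
  filter_upwards [hmax] with y hy
  linarith

theorem ViscSubsol.mono_of_isOpen {w : EuclideanSpace ℝ (Fin n) → ℝ}
    (hw : ViscSubsol H p μ Set.univ w) (hU : IsOpen U) : ViscSubsol H p μ U w := by
  intro φ hφ x hx hmax
  refine hw φ hφ x trivial ?_
  rw [IsLocalMaxOn, nhdsWithin_univ]
  rwa [IsLocalMaxOn, hU.nhdsWithin_eq hx] at hmax

/-- Below every level `μ > effectiveH H p` there is a sublinear strict subsolution. -/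
theorem IsAdmissible.exists_strict_subsol (hH : IsAdmissible H) (hμ : effectiveH H p < μ) :
    ∃ μ' < μ, ∃ w : EuclideanSpace ℝ (Fin n) → ℝ, Continuous w ∧ ViscSubsol H p μ' Set.univ w ∧
      Tendsto (fun y => w y / ‖y‖) (cobounded (EuclideanSpace ℝ (Fin n))) (𝓝 0) := by
  obtain ⟨C, hC⟩ := hH.bounded (‖p‖ + 1) (by positivity)
  have hne : {μ : ℝ | ∃ w : EuclideanSpace ℝ (Fin n) → ℝ,
      (∃ K : ℝ≥0, LipschitzWith K w) ∧ ViscSubsol H p μ Set.univ w ∧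
      Tendsto (fun y => w y / ‖y‖) (cobounded (EuclideanSpace ℝ (Fin n))) (𝓝 0)}.Nonempty := by
    -- Constants are subsolutions at any upper bound of `H p`.
    refine ⟨C, fun _ => 0, ⟨0, LipschitzWith.const 0⟩, ?_, by simpa using tendsto_const_nhds⟩
    intro φ hφ x _ hmax
    have hmin : IsLocalMin φ x := by
      rw [IsLocalMaxOn, nhdsWithin_univ] at hmax
      filter_upwards [hmax] with y hy
      linarith
    have hgrad : gradient φ x = 0 := by simp [gradient, hmin.fderiv_eq_zero]
    rw [hgrad, add_zero]
    exact (abs_le.1 (hC p (by simp) x)).2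
  obtain ⟨μ', ⟨w, ⟨K, hK⟩, hw, hlim⟩, hlt⟩ := exists_lt_of_csInf_lt hne hμ
  exact ⟨μ', hlt, w, hK.continuous, hw, hlim⟩

theorem eventually_mul_norm_lt_of_pos_liminf {v : EuclideanSpace ℝ (Fin n) → ℝ}
    (hv : 0 < liminf (fun x => ((v x / ‖x‖ : ℝ) : EReal))
      (cobounded (EuclideanSpace ℝ (Fin n)))) :
    ∃ c > 0, ∀ᶠ x in cobounded (EuclideanSpace ℝ (Fin n)), c * ‖x‖ < v x := by
  obtain ⟨c, hc0, hc⟩ := EReal.lt_iff_exists_real_btwn.1 hv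
  refine ⟨c, by exact_mod_cast hc0, ?_⟩
  filter_upwards [eventually_lt_of_lt_liminf hc, eventually_cobounded_le_norm 1] with x hx hx1
  exact (lt_div_iff₀ (by linarith)).1 (by exact_mod_cast hx)

/-- Comparison on an exterior domain, with a real bound on the boundary. -/
theorem sub_le_of_forall_frontier (hH : IsAdmissible H) (hμ : effectiveH H p < μ)
    {D : Set (EuclideanSpace ℝ (Fin n))} (hD : IsClosed D)
    {u v : EuclideanSpace ℝ (Fin n) → ℝ} (hu : UpperSemicontinuousOn u (closure Dᶜ))
    (hv : LowerSemicontinuousOn v (closure Dᶜ)) (husub : ViscSubsol H p μ Dᶜ u)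
    (hvsuper : ViscSupersol H p μ Dᶜ v)
    (hvgrowth : 0 < liminf (fun x => ((v x / ‖x‖ : ℝ) : EReal))
      (cobounded (EuclideanSpace ℝ (Fin n))))
    {M : ℝ} (hM : ∀ x ∈ frontier D, u x - v x ≤ M) {x : EuclideanSpace ℝ (Fin n)}
    (hx : x ∈ closure Dᶜ) : u x - v x ≤ M := by
  obtain ⟨μ', hμ', w, hwc, hwsub, hwlim⟩ := hH.exists_strict_subsol hμ
  obtain ⟨c, hc, hvc⟩ := eventually_mul_norm_lt_of_pos_liminf hvgrowth
  have key : ∀ C, softMin (u x) (w x + C) - v x ≤ M := by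
    intro C
    by_contra! hlt
    set Z := fun x => softMin (u x) (w x + C) - v x with hZ
    have husc : UpperSemicontinuousOn Z (closure Dᶜ) :=
      upperSemicontinuousOn_sub (upperSemicontinuousOn_softMin hu
        ((by fun_prop : Continuous fun x => w x + C).upperSemicontinuous.upperSemicontinuousOn _)) hv
    -- Far out `w y < (c / 2) * ‖y‖` and `v y > c * ‖y‖`, so `Z y < C - (c / 2) * ‖y‖`.
    have hfar : ∀ᶠ y in cobounded (EuclideanSpace ℝ (Fin n)), Z y ≤ Z x := by
      have hnorm : ∀ᶠ y in cobounded (EuclideanSpace ℝ (Fin n)), (C - Z x) / (c / 2) ≤ ‖y‖ :=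
        eventually_cobounded_le_norm _
      filter_upwards [hvc, hnorm, eventually_cobounded_le_norm 1,
        hwlim.eventually (gt_mem_nhds (by linarith : 0 < c / 2))] with y h1 h2 h3 h4
      have h4 := (div_lt_iff₀ (by linarith)).1 h4
      have h2 := (div_le_iff₀ (by linarith)).1 h2
      have h5 := softMin_le_right (u y) (w y + C)
      simp only [hZ] at h2 ⊢
      linarith
    obtain ⟨r, -, hr⟩ := (Metric.hasBasis_cobounded_compl_closedBall (0 : EuclideanSpace ℝ (Fin n))).eventually_iff.1 hfar
    obtain ⟨x₀, hx₀, hmax₀⟩ := (husc.mono Set.inter_subset_left).exists_isMaxOn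
      (s := closure Dᶜ ∩ Metric.closedBall 0 (max r ‖x‖))
      ⟨x, hx, by simp⟩ ((isCompact_closedBall _ _).inter_left isClosed_closure)
    have hle : Z x ≤ Z x₀ := hmax₀ ⟨hx, by simp⟩
    have hmax : IsMaxOn Z Dᶜ x₀ := by
      intro y hy
      by_cases hyr : y ∈ Metric.closedBall 0 (max r ‖x‖)
      · exact hmax₀ ⟨subset_closure hy, hyr⟩
      · refine le_trans (hr (fun h => hyr ?_)) hle
        exact Metric.closedBall_subset_closedBall (le_max_left _ _) h
    by_cases hx₀D : x₀ ∈ Dᶜ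
    · exact not_isMaxOn_softMin_sub hH hμ' hD.isOpen_compl (hu.mono subset_closure)
        ((by fun_prop : Continuous fun x => w x + C).upperSemicontinuous.upperSemicontinuousOn _)
        (hv.mono subset_closure) husub ((hwsub.mono_of_isOpen hD.isOpen_compl).add_const C) hvsuper
        hx₀D hmax
    · have hfr : x₀ ∈ frontier D := by
        rw [frontier_eq_closure_inter_closure]
        exact ⟨subset_closure (not_not.1 hx₀D), hx₀.1⟩
      have h1 := hM x₀ hfr
      have h2 := softMin_le_left (u x₀) (w x₀ + C)
      simp only [hZ] at hle
      linarith
  exact le_of_tendsto ((tendsto_softMin_add_atTop (u x) (w x)).sub_const (v x))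
    (Eventually.of_forall key)

end Comparison

end Eikonal

/-! ### Passage to extended-real suprema. -/

theorem proposition6p1 (n : ℕ) (hn : 1 ≤ n)
    (H : EuclideanSpace ℝ (Fin n) → EuclideanSpace ℝ (Fin n) → ℝ)
    (hH : Eikonal.IsAdmissible H)
    (p : EuclideanSpace ℝ (Fin n)) (μ : ℝ) (hμ : Eikonal.effectiveH H p < μ)
    (D : Set (EuclideanSpace ℝ (Fin n))) (hD : IsCompact D)
    (u v : EuclideanSpace ℝ (Fin n) → ℝ)
    (hu : UpperSemicontinuousOn u (closure Dᶜ))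
    (hv : LowerSemicontinuousOn v (closure Dᶜ))
    (husub : Eikonal.ViscSubsol H p μ Dᶜ u)
    (hvsuper : Eikonal.ViscSupersol H p μ Dᶜ v)
    (hvgrowth : 0 < liminf (fun x => ((v x / ‖x‖ : ℝ) : EReal))
      (cobounded (EuclideanSpace ℝ (Fin n))))
    (hugrowth : limsup (fun x => ((u x / ‖x‖ : ℝ) : EReal))
      (cobounded (EuclideanSpace ℝ (Fin n))) < ⊤) :
    ((⨆ x ∈ closure Dᶜ, ((u x - v x : ℝ) : EReal)) =
        ⨆ x ∈ frontier D, ((u x - v x : ℝ) : EReal)) ∧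
      ((∀ x ∈ frontier D, ContinuousWithinAt (fun y => u y - v y) Dᶜ x) →
        (⨆ x ∈ Dᶜ, ((u x - v x : ℝ) : EReal)) =
          ⨆ x ∈ frontier D, ((u x - v x : ℝ) : EReal)) := by
  have hsub : frontier D ⊆ closure Dᶜ := by
    rw [frontier_eq_closure_inter_closure]
    exact Set.inter_subset_right
  have hle : (⨆ x ∈ closure Dᶜ, ((u x - v x : ℝ) : EReal)) ≤
      ⨆ x ∈ frontier D, ((u x - v x : ℝ) : EReal) := by
    -- Testing against real `M` above the boundary supremum also covers the values `±∞`, including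
    -- an empty boundary.
    refine EReal.le_of_forall_lt_iff_le.1 fun M hM => iSup₂_le fun x hx => ?_
    refine EReal.coe_le_coe_iff.2 (Eikonal.sub_le_of_forall_frontier hH hμ hD.isClosed hu hv husub
      hvsuper hvgrowth (fun y hy => ?_) hx)
    exact EReal.coe_le_coe_iff.1
      ((le_iSup₂ (f := fun x (_ : x ∈ frontier D) => ((u x - v x : ℝ) : EReal)) y hy).trans hM.le)
  refine ⟨hle.antisymm (biSup_mono fun x hx => hsub hx), fun hcont => le_antisymm ?_ ?_⟩
  · exact (biSup_mono fun x hx => subset_closure hx).trans hle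
  · refine iSup₂_le fun x hx => ?_
    have : (𝓝[Dᶜ] x).NeBot := mem_closure_iff_nhdsWithin_neBot.1 (hsub hx)
    refine le_of_tendsto ((continuous_coe_real_ereal.tendsto _).comp (hcont x hx)) ?_
    filter_upwards [self_mem_nhdsWithin] with y hy
    exact le_iSup₂ (f := fun x (_ : x ∈ Dᶜ) => ((u x - v x : ℝ) : EReal)) y hy
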